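/- Let $n,k,d$ be non-negative integers with $d\ge 1$. Write $S^k(\mathbb C^n)$ for the space of homogeneous polynomials of degree $k$ in $X_1,\dots,X_n$ over $\mathbb C$, and $S^d(S^k(\mathbb C^n))$ for the space of homogeneous polynomials of degree $d$ in variables $Y_\alpha$, one for each monomial $X^\alpha$ of degree $k$; a form $p=\sum_\alpha c_\alpha X^\alpha$ in $S^k(\mathbb C^n)$ is identified with the linear form $\sum_\alpha c_\alpha Y_\alpha$. Then the map $$\iota:\mathbb P(S^k(\mathbb C^n))\to\mathbb P(S^{kd}(\mathbb C^n)),\qquad [p]\mapsto[p^d]$$ is an embedding of projective varieties, i.e. an isomorphism onto a Zariski closed subvariety. Moreover, let $\nu_d:\mathbb P(S^k(\mathbb C^n))\to\mathbb P(S^d(S^k(\mathbb C^n)))$ be the $d$-th Veronese map, which sends $[p]$ to the class of the $d$-th power of the linear form $\sum_\alpha c_\alpha Y_\alpha$, and let $\pi:S^d(S^k(\mathbb C^n))\to S^{kd}(\mathbb C^n)$ be the linear map given by the substitution $Y_\alpha\mapsto X^\alpha$. Then: 1. $\nu_d$ is an embedding of projective varieties. 2. $\pi$ is surjective, and its kernel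 $E$ is the degree-$d$ part of the ideal of the $k$-th Veronese embedding of $\mathbb P(\mathbb C^n)$, i.e. the space of all $F\in S^d(S^k(\mathbb C^n))$ with $F\big((x^\alpha)_\alpha\big)=0$ for all $x\in\mathbb C^n$. 3. The centre $\mathbb P(E)$ of the linear projection $\pi_E:\mathbb P(S^d(S^k(\mathbb C^n)))\setminus\mathbb P(E)\to\mathbb P(S^{kd}(\mathbb C^n))$, $[F]\mapsto[\pi(F)]$, does not meet the second secant variety of $\nu_d(\mathbb P(S^k(\mathbb C^n)))$, i.e. the Zariski closure of the union of the subspaces spanned by two points of $\nu_d(\mathbb P(S^k(\mathbb C^n)))$. In particular the image of $\nu_d$ is disjoint from $\mathbb P(E)$. 4. $\iota=\pi_E\circ\nu_d$. -/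

import Mathlib

noncomputable section

namespace FormPowers

open MvPolynomial

/-! ### Classical projective geometry over `ℂ`

Throughout, `V` and `W` are thought of as finite-dimensional complex vector spaces, and
`Projectivization ℂ V` is the projective space of lines in `V`. -/

section Projective

variable {V W : Type*} [AddCommGroup V] [Module ℂ V] [AddCommGroup W] [Module ℂ W]

/-- The value at `v` of a polynomial `F` in the linear functionals on `V`. On a finite-dimensional
space these are exactly the polynomial functions in the coordinates of any basis, and homogeneous
polynomials of degree `m` give exactly the homogeneous polynomial functions of degree `m`. -/
def evalAt (F : MvPolynomial (Module.Dual ℂ V) ℂ) (v : V) : ℂ :=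
  MvPolynomial.eval (fun φ : Module.Dual ℂ V => φ v) F

/-- Zariski closed subsets of `ℙ(V)`: common zero loci of sets of homogeneous polynomials. -/
def IsZariskiClosed (Z : Set (Projectivization ℂ V)) : Prop :=
  ∃ S : Set (MvPolynomial (Module.Dual ℂ V) ℂ),
    (∀ F ∈ S, ∃ m : ℕ, F.IsHomogeneous m) ∧ Z = {x | ∀ F ∈ S, ∀ v ∈ x.submodule, evalAt F v = 0}

/-- The Zariski closure of a subset of `ℙ(V)`. -/
def zariskiClosure (A : Set (Projectivization ℂ V)) : Set (Projectivization ℂ V) :=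
  ⋂₀ {Z | IsZariskiClosed Z ∧ A ⊆ Z}

/-- `Φ : V → W` is a polynomial map all of whose coordinates are homogeneous of degree `m`. -/
def IsHomogeneousPolyMap (m : ℕ) (Φ : V → W) : Prop :=
  ∀ ψ : Module.Dual ℂ W, ∃ F : MvPolynomial (Module.Dual ℂ V) ℂ,
    F.IsHomogeneous m ∧ ∀ v : V, ψ (Φ v) = evalAt F v

/-- A map from a subset `X` of `ℙ(V)` to `ℙ(W)` is regular if, in a Zariski open neighbourhood of
every point of `X`, it is given by homogeneous polynomials of one degree without common zero. -/
def IsRegularMap (X : Set (Projectivization ℂ V)) (f : X → Projectivization ℂ W) : Prop :=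
  ∀ x : X, ∃ U : Set (Projectivization ℂ V), IsZariskiClosed Uᶜ ∧ (x : Projectivization ℂ V) ∈ U ∧
    ∃ (m : ℕ) (Φ : V → W), IsHomogeneousPolyMap m Φ ∧
      ∀ (v : V) (hv : v ≠ 0) (hX : Projectivization.mk ℂ v hv ∈ X),
        Projectivization.mk ℂ v hv ∈ U →
          ∃ hΦ : Φ v ≠ 0, f ⟨Projectivization.mk ℂ v hv, hX⟩ = Projectivization.mk ℂ (Φ v) hΦ

/-- `f : ℙ(V) → ℙ(W)` is an embedding of projective varieties: a regular map whose image is Zariski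
closed and which has a regular inverse on its image, i.e. an isomorphism onto a closed
subvariety. -/
def IsProjectiveEmbedding (f : Projectivization ℂ V → Projectivization ℂ W) : Prop :=
  IsRegularMap Set.univ (fun x => f x.1) ∧ IsZariskiClosed (Set.range f) ∧
    ∃ g : Set.range f → Projectivization ℂ V,
      IsRegularMap (Set.range f) g ∧ ∀ x, g ⟨f x, Set.mem_range_self x⟩ = x

/-- The `m`-th secant variety of `X ⊆ ℙ(V)`: the Zariski closure of the union of the projective
linear subspaces spanned by `m` points of `X`. -/
def secantVariety (m : ℕ) (X : Set (Projectivization ℂ V)) : Set (Projectivization ℂ V) :=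
  zariskiClosure {y | ∃ x : Fin m → Projectivization ℂ V,
    (∀ i, x i ∈ X) ∧ y.submodule ≤ ⨆ i, (x i).submodule}

/-- The projective linear subspace `ℙ(E)` of `ℙ(V)`. -/
def projSubspace (E : Submodule ℂ V) : Set (Projectivization ℂ V) :=
  {x | x.submodule ≤ E}

/-- The projection `ℙ(V) ∖ ℙ(ker π) → ℙ(W)`, `[v] ↦ [π v]`, induced by a linear map `π`; its centre
is `ℙ(ker π)`. -/
def linearProjection (π : V →ₗ[ℂ] W) (x : Projectivization ℂ V)
    (hx : x ∉ projSubspace (LinearMap.ker π)) : Projectivization ℂ W :=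
  Projectivization.mk ℂ (π x.rep) (fun h => hx (by
    change x.submodule ≤ LinearMap.ker π
    rw [Projectivization.submodule_eq, Submodule.span_singleton_le_iff_mem]
    exact h))

/-- The map `ℙ(V) → ℙ(W)`, `[v] ↦ [Φ v]`, for a map `Φ` that is homogeneous of degree `d` and has no
zero besides the origin. -/
def projMap (d : ℕ) (Φ : V → W) (h0 : ∀ v, v ≠ 0 → Φ v ≠ 0)
    (hd : ∀ (c : ℂ) (v : V), Φ (c • v) = c ^ d • Φ v) :
    Projectivization ℂ V → Projectivization ℂ W :=
  Projectivization.lift (fun v : {v : V // v ≠ 0} => Projectivization.mk ℂ (Φ v) (h0 v v.2))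
    (by
      intro a b t hab
      have hb := h0 b b.2
      have key : Φ (a : V) = t ^ d • Φ (b : V) := by rw [hab, hd]
      exact (Projectivization.mk_eq_mk_iff' ℂ _ _ _ _).2 ⟨t ^ d, key.symm⟩)

end Projective

/-! ### Forms -/

/-- `S^k(ℂ^n)`: the forms of degree `k` in `X_1, …, X_n`. -/
abbrev Form (n k : ℕ) : Type := MvPolynomial.homogeneousSubmodule (Fin n) ℂ k

/-- The exponents of the monomials of degree `k` in `n` variables. -/
abbrev MonoIdx (n k : ℕ) : Type :=
  {α : Fin n →₀ ℕ // α ∈ (Finset.univ : Finset (Fin n)).finsuppAntidiag k}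

/-- `S^d(S^k(ℂ^n))`: the forms of degree `d` in variables `Y_α`, one for each element `X^α` of the
monomial basis of `S^k(ℂ^n)`. -/
abbrev FormOfForms (n k d : ℕ) : Type := MvPolynomial.homogeneousSubmodule (MonoIdx n k) ℂ d

/-- A form `∑ c_α X^α` of degree `k`, seen as the linear form `∑ c_α Y_α`. -/
def toLinearForm (n k : ℕ) (p : Form n k) : MvPolynomial (MonoIdx n k) ℂ :=
  ∑ α : MonoIdx n k, C (coeff α.1 p.1) * X α

lemma mem_monoIdx {n k : ℕ} {α : Fin n →₀ ℕ} :
    α ∈ (Finset.univ : Finset (Fin n)).finsuppAntidiag k ↔ α.degree = k := by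
  simp [Finset.mem_finsuppAntidiag, Finsupp.degree_eq_sum]

lemma toLinearForm_isHomogeneous (n k : ℕ) (p : Form n k) :
    (toLinearForm n k p).IsHomogeneous 1 := by
  refine IsHomogeneous.sum _ _ _ fun α _ => ?_
  simpa using (isHomogeneous_C (MonoIdx n k) (coeff α.1 p.1)).mul (isHomogeneous_X ℂ α)

lemma toLinearForm_smul (n k : ℕ) (c : ℂ) (p : Form n k) :
    toLinearForm n k (c • p) = c • toLinearForm n k p := by
  simp [toLinearForm, Finset.smul_sum, MvPolynomial.smul_eq_C_mul, mul_assoc]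

/-- The substitution `Y_α ↦ X^α`. -/
def substMonomials (n k : ℕ) : MvPolynomial (MonoIdx n k) ℂ →ₐ[ℂ] MvPolynomial (Fin n) ℂ :=
  aeval fun α : MonoIdx n k => monomial α.1 (1 : ℂ)

lemma substMonomials_toLinearForm (n k : ℕ) (p : Form n k) :
    substMonomials n k (toLinearForm n k p) = p.1 := by
  have h : ∀ α : MonoIdx n k, substMonomials n k (C (coeff α.1 p.1) * X α)
      = monomial α.1 (coeff α.1 p.1) := by
    intro α
    simp [substMonomials, C_mul_monomial]
  rw [toLinearForm, map_sum, Finset.sum_congr rfl fun α _ => h α]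
  rw [Finset.sum_coe_sort ((Finset.univ : Finset (Fin n)).finsuppAntidiag k)
    (fun α => monomial α (coeff α p.1))]
  conv_rhs => rw [p.1.as_sum]
  symm
  refine Finset.sum_subset (fun α hα => ?_) (fun α _ hα => ?_)
  · rw [mem_monoIdx]
    have hp := (mem_homogeneousSubmodule k p.1).1 p.2
    have := hp (mem_support_iff.1 hα)
    rw [Finsupp.degree_eq_weight_one]
    exact this
  · rw [notMem_support_iff.1 hα, monomial_zero]

lemma toLinearForm_ne_zero (n k : ℕ) (p : Form n k) (hp : p ≠ 0) : toLinearForm n k p ≠ 0 := by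
  intro h
  apply hp
  have := substMonomials_toLinearForm n k p
  rw [h, map_zero] at this
  exact Subtype.ext this.symm

/-- The `d`-th power `p^d ∈ S^{kd}(ℂ^n)` of a form `p ∈ S^k(ℂ^n)`. -/
def formPow (n k d : ℕ) (p : Form n k) : Form n (k * d) :=
  ⟨p.1 ^ d, (mem_homogeneousSubmodule _ _).2 (((mem_homogeneousSubmodule _ _).1 p.2).pow d)⟩

/-- The map `ι : ℙ(S^k(ℂ^n)) → ℙ(S^{kd}(ℂ^n))`, `[p] ↦ [p^d]`. -/
def powerMap (n k d : ℕ) :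
    Projectivization ℂ (Form n k) → Projectivization ℂ (Form n (k * d)) :=
  projMap d (formPow n k d)
    (fun p hp h => by
      have h1 : p.1 ^ d = 0 := congrArg Subtype.val h
      exact pow_ne_zero d (fun h2 => hp (Subtype.ext h2)) h1)
    (fun c p => Subtype.ext (by simp [formPow, smul_pow]))

/-- The `d`-th power in `S^d(S^k(ℂ^n))` of `p ∈ S^k(ℂ^n)`, seen as a linear form. -/
def linearFormPow (n k d : ℕ) (p : Form n k) : FormOfForms n k d :=
  ⟨toLinearForm n k p ^ d, (mem_homogeneousSubmodule _ _).2 (by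
    simpa using (toLinearForm_isHomogeneous n k p).pow d)⟩

/-- The `d`-th Veronese map `ν_d : ℙ(S^k(ℂ^n)) → ℙ(S^d(S^k(ℂ^n)))`. -/
def veronese (n k d : ℕ) :
    Projectivization ℂ (Form n k) → Projectivization ℂ (FormOfForms n k d) :=
  projMap d (linearFormPow n k d)
    (fun p hp h => by
      have h1 : toLinearForm n k p ^ d = 0 := congrArg Subtype.val h
      exact pow_ne_zero d (toLinearForm_ne_zero n k p hp) h1)
    (fun c p => Subtype.ext (by simp [linearFormPow, toLinearForm_smul, smul_pow]))

/-- The linear map `S^d(S^k(ℂ^n)) → S^{kd}(ℂ^n)` that multiplies out, i.e. substitutes `X^α` for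
`Y_α`. -/
def multiplyOut (n k d : ℕ) : FormOfForms n k d →ₗ[ℂ] Form n (k * d) :=
  ((substMonomials n k).toLinearMap.comp (Submodule.subtype _)).codRestrict _ (fun F =>
    (mem_homogeneousSubmodule _ _).2 (((mem_homogeneousSubmodule _ _).1 F.2).aeval _
      (fun α => isHomogeneous_monomial _ (mem_monoIdx.1 α.2))))

/-- The degree-`d` part of the ideal of the `k`-th Veronese embedding of `ℙ^{n-1}`: the forms of
degree `d` in the `Y_α` that vanish at all points `(x^α)_α`, `x ∈ ℂ^n`. -/
def veroneseIdealPart (n k d : ℕ) : Submodule ℂ (FormOfForms n k d) where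
  carrier := {F | ∀ x : Fin n → ℂ, eval (fun α : MonoIdx n k => ∏ i, x i ^ α.1 i) F.1 = 0}
  zero_mem' := by intro x; simp
  add_mem' := by intro F G hF hG x; simp [hF x, hG x]
  smul_mem' := by intro c F hF x; simp [MvPolynomial.smul_eval, hF x]

end FormPowers

end

noncomputable section

namespace FormPowers

open MvPolynomial

/-! ### Embeddings of projective spaces cut out by bilinear equations. -/

section Projective

variable {V W U : Type*} [AddCommGroup V] [Module ℂ V] [AddCommGroup W] [Module ℂ W]
  [AddCommGroup U] [Module ℂ U]

/-! Both embeddings rest on one system of equations. For `p ≠ 0` and `d ≥ 1`, the equations `p ∂ᵢF =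
d F ∂ᵢp` hold for all `i` exactly when `F` is a multiple of `p ^ d`: they say that `F` and `p ^ d`
have the same logarithmic derivatives (`exists_eq_C_mul_of_forall_mul_pderiv_eq`). They are bilinear
in `(F, p)`. Hence `[F]` lies in the image iff the linear map `p ↦ (p ∂ᵢF - d F ∂ᵢp)ᵢ` is not
injective, which is the vanishing of minors, so the image is closed. On the image the kernel of that
map is the line through `p`, and Cramer's rule expresses it locally by minors, so the inverse is
regular. `isProjectiveEmbedding_projMap` is this argument for any such bilinear system;
`isProjectiveEmbedding_projMap_of_pow` specialises it to powers and covers both `ι` and `ν_d`.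

For the secant variety, every partial derivative of `s p ^ d + t q ^ d`, with `p` and `q` linear
forms in the `Y_α`, lies in the span of `p ^ (d - 1)` and `q ^ (d - 1)`. So any three partials are
dependent, a closed condition that therefore persists on the secant variety. By Euler's formula a
form with this property is a binary form in two linear forms
(`exists_eq_homogenizedValue_of_not_linearIndependent`), hence over `ℂ` a product of linear forms in
the `Y_α` or zero. The substitution `Y_α ↦ X^α` is injective on linear forms and lands in a domain,
so it cannot kill such a product unless it is zero. -/

lemma evalAt_smul {F : MvPolynomial (Module.Dual ℂ V) ℂ} {m : ℕ} (hF : F.IsHomogeneous m)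
    (c : ℂ) (v : V) : evalAt F (c • v) = c ^ m * evalAt F v := by
  simp only [evalAt, eval_eq, Finset.mul_sum]
  refine Finset.sum_congr rfl fun s hs => ?_
  have hs' : s.degree = m := by
    by_contra h
    exact mem_support_iff.1 hs (hF.coeff_eq_zero h)
  simp only [map_smul, smul_eq_mul, mul_pow, Finset.prod_mul_distrib, Finset.prod_pow_eq_pow_sum]
  rw [← hs', Finsupp.degree_apply]
  ring

lemma evalAt_rep_mk_eq_zero_iff {F : MvPolynomial (Module.Dual ℂ V) ℂ} {m : ℕ}
    (hF : F.IsHomogeneous m) {v : V} (hv : v ≠ 0) :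
    evalAt F (Projectivization.mk ℂ v hv).rep = 0 ↔ evalAt F v = 0 := by
  obtain ⟨a, ha⟩ := Projectivization.exists_smul_eq_mk_rep ℂ v hv
  rw [← ha, Units.smul_def, evalAt_smul hF]
  simp

/-- The common zero locus of a family of homogeneous polynomials is Zariski closed. -/
lemma isZariskiClosed_zeroLocus {ι : Type*} (F : ι → MvPolynomial (Module.Dual ℂ V) ℂ) (m : ℕ)
    (hF : ∀ i, (F i).IsHomogeneous m) :
    IsZariskiClosed {x : Projectivization ℂ V | ∀ i, evalAt (F i) x.rep = 0} := by
  refine ⟨Set.range F, ?_, ?_⟩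
  · rintro _ ⟨i, rfl⟩
    exact ⟨m, hF i⟩
  · ext x
    simp only [Set.mem_ofPred_eq, Set.forall_mem_range]
    refine forall_congr' fun i => ⟨fun h v hv => ?_, fun h => h _ ?_⟩
    · rw [Projectivization.submodule_eq] at hv
      obtain ⟨c, rfl⟩ := Submodule.mem_span_singleton.1 hv
      rw [evalAt_smul (hF i), h, mul_zero]
    · rw [Projectivization.submodule_eq]
      exact Submodule.mem_span_singleton_self _

lemma isZariskiClosed_empty : IsZariskiClosed (∅ : Set (Projectivization ℂ V)) := by
  convert isZariskiClosed_zeroLocus (V := V) (fun _ : Unit => 1) 0 fun _ => isHomogeneous_one _ _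
  simp [evalAt]

lemma zariskiClosure_subset {A Z : Set (Projectivization ℂ V)} (hZ : IsZariskiClosed Z)
    (h : A ⊆ Z) : zariskiClosure A ⊆ Z :=
  Set.sInter_subset_of_mem ⟨hZ, h⟩

lemma isHomogeneousPolyMap_sum {ι : Type*} [Fintype ι] {m : ℕ}
    (F : ι → MvPolynomial (Module.Dual ℂ V) ℂ) (hF : ∀ i, (F i).IsHomogeneous m) (e : ι → W) :
    IsHomogeneousPolyMap m (fun v : V => ∑ i, evalAt (F i) v • e i) := by
  intro ψ
  refine ⟨∑ i, C (ψ (e i)) * F i, IsHomogeneous.sum _ _ _ fun i _ => (hF i).C_mul _, fun v => ?_⟩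
  simp [evalAt, mul_comm]

/-- A determinant whose `i`-th row is homogeneous of degree `m i` is homogeneous. -/
lemma isHomogeneous_det {σ ι : Type*} [Fintype ι] [DecidableEq ι]
    (M : Matrix ι ι (MvPolynomial σ ℂ)) (m : ι → ℕ) (h : ∀ i j, (M i j).IsHomogeneous (m i)) :
    M.det.IsHomogeneous (∑ i, m i) := by
  -- After transposing, each term of the expansion takes one factor `M i (τ i)` from every row, so
  -- the row degrees add up.
  rw [← Matrix.det_transpose, Matrix.det_apply']
  refine IsHomogeneous.sum _ _ _ fun τ _ => ?_
  have := (IsHomogeneous.prod Finset.univ (fun i => M i (τ i)) m fun i _ => h i _).C_mul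
    (((Equiv.Perm.sign τ : ℤ) : ℂ))
  simpa using this

lemma evalAt_det {ι : Type*} [Fintype ι] [DecidableEq ι]
    (M : Matrix ι ι (MvPolynomial (Module.Dual ℂ V) ℂ)) (v : V) :
    evalAt M.det v = (M.map fun F => evalAt F v).det :=
  RingHom.map_det _ M

/-- The range of a dual map is the annihilator of the kernel. No finiteness is asked of `U`, which
will be a space of families of polynomials. -/
lemma exists_dual_comp_eq {f : V →ₗ[ℂ] U} {l : Module.Dual ℂ V}
    (h : ∀ v, f v = 0 → l v = 0) : ∃ φ : Module.Dual ℂ U, ∀ v, φ (f v) = l v := by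
  have hl : l ∈ LinearMap.range f.dualMap := by
    rw [LinearMap.range_dualMap_eq_dualAnnihilator_ker, Submodule.mem_dualAnnihilator]
    exact h
  obtain ⟨φ, rfl⟩ := hl
  exact ⟨φ, fun v => rfl⟩

lemma exists_basis_apply_eq [FiniteDimensional ℂ V] {v : V} (hv : v ≠ 0) :
    ∃ (n : ℕ) (e : Module.Basis (Fin n) ℂ V) (i : Fin n), e i = v := by
  have hs : LinearIndepOn ℂ id ({v} : Set V) := LinearIndepOn.singleton hv
  let e := Module.Basis.extend hs
  let := FiniteDimensional.fintypeBasisIndex e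
  refine ⟨_, e.reindex (Fintype.equivFin _),
    Fintype.equivFin _ ⟨v, hs.subset_extend (Set.subset_univ _) rfl⟩, ?_⟩
  simp [e]

lemma projMap_mk (d : ℕ) {Φ : V → W} (h0 : ∀ v, v ≠ 0 → Φ v ≠ 0)
    (hd : ∀ (c : ℂ) (v : V), Φ (c • v) = c ^ d • Φ v) (v : V) (hv : v ≠ 0) :
    projMap d Φ h0 hd (Projectivization.mk ℂ v hv) = Projectivization.mk ℂ (Φ v) (h0 v hv) :=
  rfl

lemma isRegularMap_projMap (d : ℕ) {Φ : V → W} (h0 : ∀ v, v ≠ 0 → Φ v ≠ 0)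
    (hd : ∀ (c : ℂ) (v : V), Φ (c • v) = c ^ d • Φ v) (hΦ : IsHomogeneousPolyMap d Φ) :
    IsRegularMap Set.univ (fun x => projMap d Φ h0 hd x.1) := fun x =>
  ⟨Set.univ, by simpa using isZariskiClosed_empty, trivial, d, Φ, hΦ,
    fun v hv _ _ => ⟨h0 v hv, projMap_mk d h0 hd v hv⟩⟩

/-- The matrix of linear polynomials `w ↦ φ i (B w (e j))`. -/
def pairingMatrix {ι : Type*} (B : W →ₗ[ℂ] V →ₗ[ℂ] U) (e : ι → V) (φ : ι → Module.Dual ℂ U) :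
    Matrix ι ι (MvPolynomial (Module.Dual ℂ W) ℂ) :=
  Matrix.of fun i j => X ((φ i).comp (B.flip (e j)))

lemma evalAt_pairingMatrix {ι : Type*} (B : W →ₗ[ℂ] V →ₗ[ℂ] U) (e : ι → V)
    (φ : ι → Module.Dual ℂ U) (i j : ι) (w : W) :
    evalAt (pairingMatrix B e φ i j) w = φ i (B w (e j)) := by
  simp [pairingMatrix, evalAt]

lemma isHomogeneous_det_pairingMatrix {ι : Type*} [Fintype ι] [DecidableEq ι]
    (B : W →ₗ[ℂ] V →ₗ[ℂ] U) (e : ι → V) (φ : ι → Module.Dual ℂ U) :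
    (pairingMatrix B e φ).det.IsHomogeneous (Fintype.card ι) := by
  simpa using isHomogeneous_det (pairingMatrix B e φ) (fun _ => 1) fun i j => isHomogeneous_X _ _

/-- All the pairing determinants of `B w` on a family `e` vanish if and only if the family
`B w (e j)` is linearly dependent. -/
lemma forall_evalAt_det_pairingMatrix_eq_zero_iff {ι : Type*} [Fintype ι] [DecidableEq ι]
    (B : W →ₗ[ℂ] V →ₗ[ℂ] U) (e : ι → V) (w : W) :
    (∀ φ : ι → Module.Dual ℂ U, evalAt (pairingMatrix B e φ).det w = 0) ↔
      ¬ LinearIndependent ℂ fun j => B w (e j) := by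
  constructor
  · intro h hli
    have key : ∀ i, ∃ φ : Module.Dual ℂ U,
        ∀ c : ι → ℂ, φ (Fintype.linearCombination ℂ (fun j => B w (e j)) c) = c i := by
      intro i
      refine exists_dual_comp_eq (V := ι → ℂ) (l := LinearMap.proj i) fun c hc => ?_
      rw [Fintype.linearIndependent_iff] at hli
      exact hli c (by simpa [Fintype.linearCombination_apply] using hc) i
    -- These functionals are dual to the family `B w (e j)`, so their pairing matrix is the
    -- identity.
    choose φ hφ using key
    have h1 := h φ
    have h2 : ((pairingMatrix B e φ).map fun F => evalAt F w) = 1 := by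
      ext i j
      have := hφ i (Pi.single j 1)
      rw [Fintype.linearCombination_apply_single, one_smul] at this
      rw [Matrix.map_apply, evalAt_pairingMatrix, this, Matrix.one_apply, Pi.single_apply]
    rw [evalAt_det, h2, Matrix.det_one] at h1
    exact one_ne_zero h1
  · intro h φ
    rw [Fintype.not_linearIndependent_iff] at h
    obtain ⟨c, hc, j, hj⟩ := h
    rw [evalAt_det, ← Matrix.exists_mulVec_eq_zero_iff]
    refine ⟨c, fun h0 => hj (congrFun h0 j), ?_⟩
    ext i
    have := congrArg (φ i) hc
    simpa [Matrix.mulVec, dotProduct, evalAt_pairingMatrix, mul_comm] using this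

/-- If the lines `[v]` and `[Φ v]` determine each other through the bilinear equations
`B (Φ v) v = 0`, then `[v] ↦ [Φ v]` has a Zariski closed image. -/
lemma isZariskiClosed_range_projMap [FiniteDimensional ℂ V] {d : ℕ} {Φ : V → W}
    (h0 : ∀ v, v ≠ 0 → Φ v ≠ 0) (hd : ∀ (c : ℂ) (v : V), Φ (c • v) = c ^ d • Φ v)
    (B : W →ₗ[ℂ] V →ₗ[ℂ] U) (hB : ∀ v, B (Φ v) v = 0)
    (hB' : ∀ w v, v ≠ 0 → B w v = 0 → ∃ c : ℂ, w = c • Φ v) :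
    IsZariskiClosed (Set.range (projMap d Φ h0 hd)) := by
  classical
  let e := Module.finBasis ℂ V
  convert isZariskiClosed_zeroLocus
    (fun φ : Fin (Module.finrank ℂ V) → Module.Dual ℂ U => (pairingMatrix B e φ).det) _
    (isHomogeneous_det_pairingMatrix B e) using 1
  ext x
  induction x with | h w hw =>
  simp only [Set.mem_ofPred_eq, Set.mem_range,
    evalAt_rep_mk_eq_zero_iff (isHomogeneous_det_pairingMatrix B e _)]
  rw [forall_evalAt_det_pairingMatrix_eq_zero_iff]
  -- As `e` is a basis, independence of the images means injectivity of `B w`.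
  have hli : (LinearIndependent ℂ fun j => B w (e j)) ↔ ∀ v, B w v = 0 → v = 0 := by
    have hsum : ∀ c : Fin (Module.finrank ℂ V) → ℂ,
        ∑ j, c j • B w (e j) = B w (e.equivFun.symm c) := by simp [e.equivFun_symm_apply]
    simp only [Fintype.linearIndependent_iff, hsum]
    refine ⟨fun h v hv => ?_, fun h c hc => congrFun (?_ : c = 0)⟩
    · rw [← e.equivFun.map_eq_zero_iff]
      exact funext (h _ (by rwa [e.equivFun.symm_apply_apply]))
    · exact e.equivFun.symm.map_eq_zero_iff.1 (h _ hc)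
  rw [hli]
  push Not
  constructor
  · rintro ⟨x, hx⟩
    induction x with | h v hv =>
    rw [projMap_mk, Projectivization.mk_eq_mk_iff'] at hx
    obtain ⟨c, hc⟩ := hx
    have hc0 : c ≠ 0 := by
      rintro rfl
      rw [zero_smul] at hc
      exact h0 v hv hc.symm
    refine ⟨v, ?_, hv⟩
    have := hB v
    rw [← hc, map_smul, LinearMap.smul_apply] at this
    exact (smul_eq_zero.1 this).resolve_left hc0
  · rintro ⟨v, hwv, hv⟩
    obtain ⟨c, rfl⟩ := hB' w v hv hwv
    refine ⟨Projectivization.mk ℂ v hv, ?_⟩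
    rw [projMap_mk]
    exact (Projectivization.mk_eq_mk_iff' ℂ _ _ _ _).2
      ⟨c⁻¹, inv_smul_smul₀ (fun h => hw (by rw [h, zero_smul])) _⟩

/-- The inverse of `[v] ↦ [Φ v]` on its image is given by minors of the bilinear equations. -/
lemma isRegularMap_inverse_projMap [FiniteDimensional ℂ V] {d : ℕ} {Φ : V → W}
    (h0 : ∀ v, v ≠ 0 → Φ v ≠ 0) (hd : ∀ (c : ℂ) (v : V), Φ (c • v) = c ^ d • Φ v)
    (B : W →ₗ[ℂ] V →ₗ[ℂ] U) (hB : ∀ v, B (Φ v) v = 0)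
    (hker : ∀ v v', v ≠ 0 → B (Φ v) v' = 0 → ∃ c : ℂ, v' = c • v)
    (g : Set.range (projMap d Φ h0 hd) → Projectivization ℂ V)
    (hg : ∀ x, g ⟨projMap d Φ h0 hd x, Set.mem_range_self x⟩ = x) :
    IsRegularMap (Set.range (projMap d Φ h0 hd)) g := by
  classical
  rintro ⟨_, x, rfl⟩
  induction x with | h v₀ hv₀ =>
  obtain ⟨N, e, i₀, he⟩ := exists_basis_apply_eq hv₀
  -- The kernel of `B (Φ v₀)` lies in the line of `v₀ = e i₀`, on which the other coordinates
  -- vanish, so these factor through `B (Φ v₀)`. The value at `i₀` is irrelevant, since that row is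
  -- replaced below.
  have hφ : ∀ i, ∃ φ : Module.Dual ℂ U, i ≠ i₀ → ∀ v, φ (B (Φ v₀) v) = e.coord i v := by
    intro i
    by_cases hi : i = i₀
    · exact ⟨0, fun h => absurd hi h⟩
    · obtain ⟨φ, hφ⟩ := exists_dual_comp_eq (f := B (Φ v₀)) (l := e.coord i) fun v hv => by
        obtain ⟨c, rfl⟩ := hker v₀ v hv₀ hv
        simp [← he, Ne.symm hi]
      exact ⟨φ, fun _ => hφ⟩
  choose φ hφ using hφ
  -- Row `i₀` reads off the coordinate `i₀`; the other rows are bilinear equations chosen so that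
  -- `P` is the identity at `Φ v₀`. The constant row explains the degree `0` in `m`.
  let P : Matrix (Fin N) (Fin N) (MvPolynomial (Module.Dual ℂ W) ℂ) :=
    (pairingMatrix B e φ).updateRow i₀ (Pi.single i₀ 1)
  let m : Fin N → ℕ := fun i => if i = i₀ then 0 else 1
  have hrow : ∀ j₀ i j, ((pairingMatrix B e φ).updateRow i₀ (Pi.single j₀ 1) i j).IsHomogeneous
      (m i) := by
    intro j₀ i j
    by_cases hi : i = i₀
    · subst hi
      by_cases hj : j = j₀
      · subst hj
        simpa [m] using isHomogeneous_one _ _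
      · simpa [m, hj] using isHomogeneous_zero _ _ _
    · simpa [m, hi, pairingMatrix] using isHomogeneous_X _ _
  have hdet : P.det.IsHomogeneous (∑ i, m i) := isHomogeneous_det _ _ (hrow i₀)
  have hadj : ∀ j, (P.adjugate j i₀).IsHomogeneous (∑ i, m i) := by
    intro j
    -- A cofactor along row `i₀` only replaces the constant row by another constant row, so all
    -- these entries share one degree.
    rw [Matrix.adjugate_apply, Matrix.updateRow_idem]
    exact isHomogeneous_det _ _ (hrow j)
  let M : W → Matrix (Fin N) (Fin N) ℂ := fun w => P.map fun F => evalAt F w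
  have hM : ∀ w v i, (M w).mulVec (e.repr v) i =
      if i = i₀ then e.repr v i₀ else φ i (B w v) := by
    intro w v i
    by_cases hi : i = i₀
    · subst hi
      simp [M, P, Matrix.mulVec, dotProduct, Pi.single_apply, apply_ite (fun F => evalAt F w)]
      simp [evalAt]
    · rw [if_neg hi]
      conv_rhs => rw [← e.sum_repr v, map_sum, map_sum]
      simp [M, P, Matrix.mulVec, dotProduct, hi, evalAt_pairingMatrix, mul_comm]
  refine ⟨{y | evalAt P.det y.rep ≠ 0}, ?_, ?_, ∑ i, m i,
    fun w => ∑ j, evalAt (P.adjugate j i₀) w • e j, isHomogeneousPolyMap_sum _ hadj _, ?_⟩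
  · convert isZariskiClosed_zeroLocus (fun _ : Unit => P.det) _ (fun _ => hdet) using 1
    ext y
    simp
  · change ¬ evalAt P.det (Projectivization.mk ℂ (Φ v₀) (h0 v₀ hv₀)).rep = 0
    rw [evalAt_rep_mk_eq_zero_iff hdet, evalAt_det]
    have h1 : M (Φ v₀) = 1 := by
      ext i j
      have := hM (Φ v₀) (e j) i
      rw [e.repr_self, Finsupp.single_eq_pi_single, Matrix.mulVec_single_one] at this
      rw [show M (Φ v₀) i j = (M (Φ v₀)).col j i from rfl, this, Matrix.one_apply]
      by_cases hi : i = i₀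
      · simp [hi, Pi.single_apply]
      · simp [hi, hφ i hi, Finsupp.single_apply, eq_comm]
    change (M (Φ v₀)).det ≠ 0
    rw [h1, Matrix.det_one]
    exact one_ne_zero
  · rintro w hw ⟨p, hp⟩ hU
    induction p with | h p hp0 =>
    have hU' : (M w).det ≠ 0 := by
      have := (evalAt_rep_mk_eq_zero_iff hdet hw).not.1 hU
      rwa [evalAt_det] at this
    have hBw : B w p = 0 := by
      rw [projMap_mk, eq_comm, Projectivization.mk_eq_mk_iff'] at hp
      obtain ⟨c, rfl⟩ := hp
      rw [map_smul, LinearMap.smul_apply, hB, smul_zero]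
    have hadjM : ∀ j, evalAt (P.adjugate j i₀) w = (M w).adjugate j i₀ := by
      intro j
      have := RingHom.map_adjugate (MvPolynomial.eval fun φ : Module.Dual ℂ W => φ w) P
      exact congrFun (congrFun this j) i₀
    -- Cramer's rule: if `B w p = 0`, then `M w` sends the coordinates of `p` to a multiple of the
    -- `i₀`-th unit vector, so column `i₀` of the adjugate is proportional to `p`.
    have key : e.repr p i₀ • ∑ j, evalAt (P.adjugate j i₀) w • e j = (M w).det • p := by
      have h1 : (M w).mulVec (e.repr p) = Pi.single i₀ (e.repr p i₀) := by
        ext i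
        rw [hM, hBw, Pi.single_apply, map_zero]
      have h2 := congrArg (M w).adjugate.mulVec h1
      rw [Matrix.mulVec_mulVec, Matrix.adjugate_mul, Matrix.smul_mulVec, Matrix.one_mulVec] at h2
      conv_rhs => rw [← e.sum_repr p]
      rw [Finset.smul_sum, Finset.smul_sum]
      refine Finset.sum_congr rfl fun j _ => ?_
      have h3 := congrFun h2 j
      simp only [Pi.smul_apply, smul_eq_mul, Matrix.mulVec_single, MulOpposite.smul_eq_mul_unop,
        MulOpposite.unop_op, Matrix.col_apply] at h3
      rw [smul_smul, smul_smul, h3, hadjM, mul_comm]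
    have hne : (M w).det • p ≠ 0 := smul_ne_zero hU' hp0
    rw [← key] at hne
    refine ⟨right_ne_zero_of_smul hne, ?_⟩
    have hgp := hg (Projectivization.mk ℂ p hp0)
    have : (⟨Projectivization.mk ℂ w hw, ⟨_, hp⟩⟩ : Set.range (projMap d Φ h0 hd)) =
      ⟨projMap d Φ h0 hd (Projectivization.mk ℂ p hp0), Set.mem_range_self _⟩ := Subtype.ext hp.symm
    rw [this, hgp]
    refine (Projectivization.mk_eq_mk_iff' ℂ _ _ _ _).2 ⟨(M w).det⁻¹ * e.repr p i₀, ?_⟩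
    rw [mul_smul, key, inv_smul_smul₀ hU']

/-- If `[v]` and `[Φ v]` determine each other through the bilinear equations `B (Φ v) v = 0`, then
`[v] ↦ [Φ v]` is an embedding. -/
theorem isProjectiveEmbedding_projMap [FiniteDimensional ℂ V] {d : ℕ} {Φ : V → W}
    (h0 : ∀ v, v ≠ 0 → Φ v ≠ 0) (hd : ∀ (c : ℂ) (v : V), Φ (c • v) = c ^ d • Φ v)
    (hΦ : IsHomogeneousPolyMap d Φ) (B : W →ₗ[ℂ] V →ₗ[ℂ] U) (hB : ∀ v, B (Φ v) v = 0)
    (hB' : ∀ w v, v ≠ 0 → B w v = 0 → ∃ c : ℂ, w = c • Φ v)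
    (hker : ∀ v v', v ≠ 0 → B (Φ v) v' = 0 → ∃ c : ℂ, v' = c • v) :
    IsProjectiveEmbedding (projMap d Φ h0 hd) := by
  have hinj : Function.Injective (projMap d Φ h0 hd) := by
    intro x y hxy
    induction x with | h v hv =>
    induction y with | h v' hv' =>
    rw [projMap_mk, projMap_mk, Projectivization.mk_eq_mk_iff'] at hxy
    obtain ⟨c, hc⟩ := hxy
    obtain ⟨a, ha⟩ := hker v v' hv (by rw [← hc, map_smul, LinearMap.smul_apply, hB, smul_zero])
    exact ((Projectivization.mk_eq_mk_iff' ℂ _ _ _ _).2 ⟨a, ha.symm⟩).symm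
  let g : Set.range (projMap d Φ h0 hd) → Projectivization ℂ V := fun y => y.2.choose
  have hg : ∀ x, g ⟨projMap d Φ h0 hd x, Set.mem_range_self x⟩ = x := fun x =>
    hinj (Set.mem_range_self (f := projMap d Φ h0 hd) x).choose_spec
  exact ⟨isRegularMap_projMap d h0 hd hΦ, isZariskiClosed_range_projMap h0 hd B hB hB', g,
    isRegularMap_inverse_projMap h0 hd B hB hker g hg, hg⟩

end Projective

/-! ### Logarithmic derivatives and the equations of powers. -/

section Powers

variable {σ : Type*}

/-- The operator `X i * pderiv i` is diagonal on monomials, so it does not raise the leading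
monomial and multiplies the leading coefficient by an exponent. -/
lemma coeff_X_mul_pderiv (i : σ) (P : MvPolynomial σ ℂ) (m : σ →₀ ℕ) :
    coeff m (X i * pderiv i P) = m i * coeff m P := by
  classical
  rw [coeff_X_mul']
  split_ifs with h
  · have hi : 1 ≤ m i := Nat.one_le_iff_ne_zero.2 (Finsupp.mem_support_iff.1 h)
    have hm : m - Finsupp.single i 1 + Finsupp.single i 1 = m :=
      tsub_add_cancel_of_le (Finsupp.single_le_iff.2 hi)
    rw [coeff_pderiv, hm, Finsupp.tsub_apply, Finsupp.single_eq_same, Nat.cast_sub hi]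
    push_cast
    ring
  · rw [Finsupp.notMem_support_iff.1 h, Nat.cast_zero, zero_mul]

/-- Two polynomials with the same logarithmic derivatives are proportional. -/
lemma exists_eq_C_mul_of_forall_mul_pderiv_eq [Finite σ] {P Q : MvPolynomial σ ℂ} (hP : P ≠ 0)
    (h : ∀ i, P * pderiv i Q = Q * pderiv i P) : ∃ c : ℂ, Q = C c * P := by
  obtain ⟨N, ⟨f⟩⟩ := Finite.exists_equiv_fin σ
  let _ : LinearOrder σ := LinearOrder.lift' f f.injective
  let o : MonomialOrder σ := MonomialOrder.lex
  have hlP : o.leadingCoeff P ≠ 0 := o.leadingCoeff_ne_zero_iff.2 hP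
  -- This constant makes `R = Q - c P` lose the leading monomial of `P`.
  refine ⟨coeff (o.degree P) Q / o.leadingCoeff P, ?_⟩
  by_contra hne
  set R := Q - C (coeff (o.degree P) Q / o.leadingCoeff P) * P with hR
  have hR0 : R ≠ 0 := sub_ne_zero.2 hne
  have hlR : o.leadingCoeff R ≠ 0 := o.leadingCoeff_ne_zero_iff.2 hR0
  have hcR : coeff (o.degree P) R = 0 := by
    rw [hR, coeff_sub, coeff_C_mul]
    change _ - _ * o.leadingCoeff P = 0
    rw [div_mul_cancel₀ _ hlP, sub_self]
  have hRP : ∀ i, P * (X i * pderiv i R) = R * (X i * pderiv i P) := by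
    intro i
    have hR' : pderiv i R = pderiv i Q - C (coeff (o.degree P) Q / o.leadingCoeff P) *
        pderiv i P := by
      rw [hR, map_sub, pderiv_C_mul]
    rw [hR']
    linear_combination (X i) * h i
  have hdeg : ∀ (i : σ) (S : MvPolynomial σ ℂ), o.toSyn (o.degree (X i * pderiv i S)) ≤
      o.toSyn (o.degree S) := by
    intro i S
    rw [o.degree_le_iff]
    intro s hs
    refine o.le_degree (mem_support_iff.2 fun h0 => mem_support_iff.1 hs ?_)
    rw [coeff_X_mul_pderiv, h0, mul_zero]
  -- `R` inherits the relations of `Q`. Comparing top coefficients in `P * (X i * pderiv i R) = R *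
  -- (X i * pderiv i P)` equates the exponents of the two leading monomials, as the characteristic
  -- is zero; but `R` has no such monomial.
  have hmm : o.degree R = o.degree P := by
    ext i
    have h1 := o.coeff_mul_of_add_of_degree_le (f := P) (le_refl _) (hdeg i R)
    have h2 := o.coeff_mul_of_add_of_degree_le (f := R) (le_refl _) (hdeg i P)
    rw [hRP, add_comm, h2, coeff_X_mul_pderiv, coeff_X_mul_pderiv] at h1
    change o.leadingCoeff R * (_ * o.leadingCoeff P) =
      o.leadingCoeff P * (_ * o.leadingCoeff R) at h1
    have h3 : ((o.degree P i : ℕ) : ℂ) = (o.degree R i : ℕ) := by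
      refine mul_right_cancel₀ (mul_ne_zero hlP hlR) ?_
      linear_combination h1
    exact_mod_cast h3.symm
  exact hlR (by rw [MonomialOrder.leadingCoeff, hmm, hcR])

variable {V W : Type*} [AddCommGroup V] [Module ℂ V] [AddCommGroup W] [Module ℂ W]

/-- The bilinear equations `p ∂ᵢF = d F ∂ᵢp` that relate a polynomial `p` to its power `F = p ^ d`,
for `p` and `F` depending linearly on parameters. -/
def powerEquations (d : ℕ) (a : V →ₗ[ℂ] MvPolynomial σ ℂ) (b : W →ₗ[ℂ] MvPolynomial σ ℂ) :
    W →ₗ[ℂ] V →ₗ[ℂ] (σ → MvPolynomial σ ℂ) :=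
  LinearMap.mk₂ ℂ (fun w v i => a v * pderiv i (b w) - d * (b w * pderiv i (a v)))
    (fun w w' v => by ext1 i; simp only [map_add, Pi.add_apply]; ring)
    (fun c w v => by
      ext1 i
      simp only [map_smul, Derivation.map_smul, Pi.smul_apply, smul_sub, mul_smul_comm,
        smul_mul_assoc])
    (fun w v v' => by ext1 i; simp only [map_add, Pi.add_apply]; ring)
    (fun c w v => by
      ext1 i
      simp only [map_smul, Derivation.map_smul, Pi.smul_apply, smul_sub, mul_smul_comm,
        smul_mul_assoc])

lemma powerEquations_eq_zero_iff {d : ℕ} {a : V →ₗ[ℂ] MvPolynomial σ ℂ}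
    {b : W →ₗ[ℂ] MvPolynomial σ ℂ} {w : W} {v : V} :
    powerEquations d a b w v = 0 ↔ ∀ i, a v * pderiv i (b w) = d * (b w * pderiv i (a v)) := by
  simp [powerEquations, funext_iff, sub_eq_zero]

/-- Induction on `d`: one factor `a v` is expanded in a basis, and multiplication by each `a (e j)`
is absorbed into the functional. -/
lemma exists_isHomogeneous_eval_eq_pow [FiniteDimensional ℂ V] (a : V →ₗ[ℂ] MvPolynomial σ ℂ)
    (d : ℕ) (ψ : Module.Dual ℂ (MvPolynomial σ ℂ)) :
    ∃ F : MvPolynomial (Module.Dual ℂ V) ℂ, F.IsHomogeneous d ∧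
      ∀ v, ψ (a v ^ d) = evalAt F v := by
  induction d generalizing ψ with
  | zero => exact ⟨C (ψ 1), isHomogeneous_C _ _, fun v => by simp [evalAt]⟩
  | succ d ih =>
    let e := Module.finBasis ℂ V
    choose F hF hF' using fun j => ih (ψ.comp (LinearMap.mulRight ℂ (a (e j))))
    refine ⟨∑ j, F j * X (e.coord j),
      IsHomogeneous.sum _ _ _ fun j _ => (hF j).mul (isHomogeneous_X _ _), fun v => ?_⟩
    have h1 : ∀ j, evalAt (F j) v = ψ (a v ^ d * a (e j)) := fun j => (hF' j v).symm
    have h2 : evalAt (∑ j, F j * X (e.coord j)) v = ∑ j, evalAt (F j) v * e.repr v j := by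
      simp [evalAt]
    have h3 : ∀ q, ψ (q * a v) = ∑ j, ψ (q * a (e j)) * e.repr v j := by
      intro q
      conv_lhs => rw [← e.sum_repr v, map_sum, Finset.mul_sum, map_sum]
      refine Finset.sum_congr rfl fun j _ => ?_
      rw [map_smul, mul_smul_comm, map_smul, smul_eq_mul, mul_comm]
    rw [h2, pow_succ, h3]
    simp only [h1]

/-- If `b (Φ v) = a v ^ d` for injective linear maps `a` and `b` into a polynomial ring, then
`[v] ↦ [Φ v]` is an embedding. -/
theorem isProjectiveEmbedding_projMap_of_pow [Finite σ] [FiniteDimensional ℂ V] {d : ℕ}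
    (hd0 : 0 < d) {Φ : V → W} (h0 : ∀ v, v ≠ 0 → Φ v ≠ 0)
    (hd : ∀ (c : ℂ) (v : V), Φ (c • v) = c ^ d • Φ v)
    (a : V →ₗ[ℂ] MvPolynomial σ ℂ) (ha : Function.Injective a)
    (b : W →ₗ[ℂ] MvPolynomial σ ℂ) (hb : Function.Injective b)
    (hΦ : ∀ v, b (Φ v) = a v ^ d) : IsProjectiveEmbedding (projMap d Φ h0 hd) := by
  obtain ⟨n, rfl⟩ := Nat.exists_eq_add_of_lt hd0
  rw [zero_add] at *
  have hpd : ∀ i v, pderiv i (a v ^ (n + 1)) = (n + 1 : ℕ) * (a v ^ n * pderiv i (a v)) := by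
    intro i v
    rw [Derivation.leibniz_pow]
    simp
  have ha0 : ∀ v, v ≠ 0 → a v ≠ 0 := fun v hv => (map_ne_zero_iff a ha).2 hv
  refine isProjectiveEmbedding_projMap h0 hd (fun ψ => ?_) (powerEquations (n + 1) a b)
    (fun v => ?_) (fun w v hv h => ?_) (fun v v' hv h => ?_)
  · obtain ⟨ψ', hψ'⟩ := exists_dual_comp_eq (f := b) (l := ψ) fun w hw => by
      rw [(map_eq_zero_iff b hb).1 hw, map_zero]
    obtain ⟨F, hF, hF'⟩ := exists_isHomogeneous_eval_eq_pow a (n + 1) ψ'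
    exact ⟨F, hF, fun v => by rw [← hF', ← hΦ, hψ']⟩
  · rw [powerEquations_eq_zero_iff]
    intro i
    rw [hΦ, hpd]
    ring
  · rw [powerEquations_eq_zero_iff] at h
    obtain ⟨c, hc⟩ := exists_eq_C_mul_of_forall_mul_pderiv_eq (P := a v ^ (n + 1)) (Q := b w)
      (pow_ne_zero _ (ha0 v hv)) fun i => by
        rw [hpd]
        linear_combination (a v ^ n) * h i
    refine ⟨c, hb ?_⟩
    rw [hc, map_smul, hΦ, smul_eq_C_mul]
  · rw [powerEquations_eq_zero_iff] at h
    obtain ⟨c, hc⟩ := exists_eq_C_mul_of_forall_mul_pderiv_eq (Q := a v') (ha0 v hv) fun i => by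
      have hn : ((n + 1 : ℕ) : MvPolynomial σ ℂ) ≠ 0 := Nat.cast_ne_zero.2 n.succ_ne_zero
      -- Cancelling the factor `d p ^ (d - 1)` leaves the logarithmic derivative relation between `a
      -- v` and `a v'`.
      refine mul_left_cancel₀ (mul_ne_zero hn (pow_ne_zero n (ha0 v hv))) ?_
      have := h i
      rw [hΦ, hpd] at this
      linear_combination -this
    exact ⟨c, ha (by rw [hc, map_smul, smul_eq_C_mul])⟩

end Powers

/-! ### Binary forms split into linear factors. -/

section BinaryForms

variable {A R : Type*} [CommRing A] [Algebra ℂ A] [CommRing R] [IsDomain R] [Algebra ℂ R]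

/-- The value at `(x, y)` of the degree `d` homogenization of a polynomial `p`. -/
def homogenizedValue (d : ℕ) (x y : A) : Polynomial ℂ →ₗ[ℂ] A :=
  ∑ i ∈ Finset.range (d + 1), (Polynomial.lcoeff ℂ i).smulRight (x ^ i * y ^ (d - i))

lemma homogenizedValue_apply (d : ℕ) (x y : A) (p : Polynomial ℂ) :
    homogenizedValue d x y p = ∑ i ∈ Finset.range (d + 1), p.coeff i • (x ^ i * y ^ (d - i)) := by
  simp [homogenizedValue]

lemma homogenizedValue_X_mul (d : ℕ) (x y : A) (p : Polynomial ℂ) :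
    homogenizedValue (d + 1) x y (Polynomial.X * p) = x * homogenizedValue d x y p := by
  rw [homogenizedValue_apply, homogenizedValue_apply, Finset.sum_range_succ', Finset.mul_sum]
  simp only [Polynomial.coeff_X_mul, Polynomial.coeff_X_mul_zero, zero_smul, add_zero,
    Nat.add_sub_add_right]
  refine Finset.sum_congr rfl fun i _ => ?_
  rw [mul_smul_comm, pow_succ']
  ring_nf

lemma homogenizedValue_succ (d : ℕ) (x y : A) {p : Polynomial ℂ} (hp : p.natDegree ≤ d) :
    homogenizedValue (d + 1) x y p = y * homogenizedValue d x y p := by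
  rw [homogenizedValue_apply, homogenizedValue_apply, Finset.sum_range_succ, Finset.mul_sum,
    Polynomial.coeff_eq_zero_of_natDegree_lt (Nat.lt_succ_of_le hp), zero_smul, add_zero]
  refine Finset.sum_congr rfl fun i hi => ?_
  rw [mul_smul_comm, Nat.succ_sub (Nat.le_of_lt_succ (Finset.mem_range.1 hi)), pow_succ']
  ring_nf

/-- A binary form over `ℂ` is a product of linear forms, so an algebra homomorphism to a domain that
kills no nonzero combination of `x` and `y` kills no nonzero value of a binary form at `(x, y)`. -/
lemma homogenizedValue_eq_zero_of_map_eq_zero (f : A →ₐ[ℂ] R) {x y : A}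
    (hf : ∀ s t : ℂ, f (s • x + t • y) = 0 → s • x + t • y = 0) (d : ℕ) (p : Polynomial ℂ)
    (hp : p.natDegree ≤ d) (h : f (homogenizedValue d x y p) = 0) :
    homogenizedValue d x y p = 0 := by
  induction d generalizing p with
  | zero =>
    rw [homogenizedValue_apply] at h ⊢
    simp only [zero_add, Finset.range_one, Finset.sum_singleton, pow_zero, mul_one, map_smul,
      map_one, Nat.sub_self] at h ⊢
    rw [(smul_eq_zero.1 h).resolve_right one_ne_zero, zero_smul]
  | succ d ih =>
    -- A drop in degree is a root at infinity, which gives the factor `y`; otherwise a root `r` of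
    -- `p` gives the factor `x - r y`.
    by_cases hpd : p.natDegree ≤ d
    · rw [homogenizedValue_succ d x y hpd] at h ⊢
      rw [map_mul] at h
      rcases mul_eq_zero.1 h with h | h
      · have := hf 0 1 (by simpa using h)
        rw [show y = 0 by simpa using this, zero_mul]
      · rw [ih p hpd h, mul_zero]
    · obtain ⟨r, hr⟩ := IsAlgClosed.exists_root p fun h0 => by
        rw [Polynomial.natDegree_eq_of_degree_eq_some h0] at hpd
        exact hpd (Nat.zero_le _)
      obtain ⟨q, rfl⟩ := Polynomial.dvd_iff_isRoot.2 hr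
      have hq0 : q ≠ 0 := by
        rintro rfl
        simp at hpd
      have hq : q.natDegree ≤ d := by
        rw [Polynomial.natDegree_mul (Polynomial.X_sub_C_ne_zero r) hq0,
          Polynomial.natDegree_X_sub_C] at hp
        omega
      have key : homogenizedValue (d + 1) x y ((Polynomial.X - Polynomial.C r) * q) =
          ((1 : ℂ) • x + (-r) • y) * homogenizedValue d x y q := by
        rw [sub_mul, map_sub, homogenizedValue_X_mul, ← Polynomial.smul_eq_C_mul, map_smul,
          homogenizedValue_succ d x y hq]
        simp [add_mul, sub_eq_add_neg]
      rw [key] at h ⊢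
      rw [map_mul] at h
      rcases mul_eq_zero.1 h with h | h
      · rw [hf _ _ h, zero_mul]
      · rw [ih q hq h, mul_zero]

end BinaryForms

/-! ### Forms whose partial derivatives span at most a plane. -/

section Catalecticant

variable {σ : Type*}

lemma pderiv_pderiv_comm (α β : σ) (F : MvPolynomial σ ℂ) :
    pderiv α (pderiv β F) = pderiv β (pderiv α F) := by
  ext m
  simp only [coeff_pderiv]
  by_cases h : α = β
  · rw [h]
  · simp [add_right_comm m, h, Ne.symm h]
    ring

variable [Fintype σ]

/-- The directional derivative of polynomials, as a bilinear map. -/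
def dirDeriv : MvPolynomial σ ℂ →ₗ[ℂ] (σ → ℂ) →ₗ[ℂ] MvPolynomial σ ℂ :=
  LinearMap.mk₂ ℂ (fun F u => ∑ α, u α • pderiv α F)
    (fun F G u => by simp [Finset.sum_add_distrib])
    (fun c F u => by simp [Finset.smul_sum, smul_comm c])
    (fun F u v => by simp [add_smul, Finset.sum_add_distrib])
    (fun c F u => by simp [Finset.smul_sum, mul_smul])

lemma dirDeriv_apply (F : MvPolynomial σ ℂ) (u : σ → ℂ) :
    dirDeriv F u = ∑ α, u α • pderiv α F := rfl

lemma dirDeriv_single [DecidableEq σ] (F : MvPolynomial σ ℂ) (α : σ) :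
    dirDeriv F (Pi.single α 1) = pderiv α F := by
  simp [dirDeriv_apply, Pi.single_apply]

lemma pderiv_dirDeriv (F : MvPolynomial σ ℂ) (u : σ → ℂ) (α : σ) :
    pderiv α (dirDeriv F u) = dirDeriv (pderiv α F) u := by
  simp [dirDeriv_apply, pderiv_pderiv_comm α]

lemma dirDeriv_dirDeriv_comm (F : MvPolynomial σ ℂ) (u v : σ → ℂ) :
    dirDeriv (dirDeriv F u) v = dirDeriv (dirDeriv F v) u := by
  conv_lhs => rw [dirDeriv_apply]
  conv_rhs => rw [dirDeriv_apply F]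
  simp [pderiv_dirDeriv]

lemma isHomogeneous_dirDeriv {d : ℕ} {F : MvPolynomial σ ℂ} (hF : F.IsHomogeneous (d + 1))
    (u : σ → ℂ) : (dirDeriv F u).IsHomogeneous d := by
  rw [dirDeriv_apply]
  refine IsHomogeneous.sum _ _ _ fun α _ => ?_
  rw [smul_eq_C_mul]
  exact (hF.pderiv (i := α)).C_mul _

/-- A form all of whose partial derivatives are combinations of two directional derivatives is a
binary form in two linear forms. -/
lemma exists_eq_homogenizedValue (a b : σ → ℂ) (u v : σ → ℂ) (d : ℕ) (F : MvPolynomial σ ℂ)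
    (hF : F.IsHomogeneous d)
    (h : ∀ α, pderiv α F = a α • dirDeriv F u + b α • dirDeriv F v) :
    ∃ p : Polynomial ℂ, p.natDegree ≤ d ∧
      F = homogenizedValue d (∑ α, a α • X α) (∑ α, b α • X α) p := by
  induction d generalizing F with
  | zero =>
    refine ⟨Polynomial.C (coeff 0 F), by simp, ?_⟩
    rw [homogenizedValue_apply]
    simpa [smul_eq_C_mul] using (totalDegree_eq_zero_iff_eq_C.1 (Nat.le_zero.1 hF.totalDegree_le))
  | succ d ih =>
    have hD : ∀ w, ∃ p : Polynomial ℂ, p.natDegree ≤ d ∧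
        dirDeriv F w = homogenizedValue d (∑ α, a α • X α) (∑ α, b α • X α) p := fun w => by
      refine ih _ (isHomogeneous_dirDeriv hF w) fun α => ?_
      -- Derivatives commute and `a`, `b` are constants, so the hypothesis passes to directional
      -- derivatives with the same `a`, `b`, and hence the same two linear forms.
      rw [pderiv_dirDeriv, h, map_add, map_smul, map_smul, LinearMap.add_apply,
        LinearMap.smul_apply, LinearMap.smul_apply, dirDeriv_dirDeriv_comm F u,
        dirDeriv_dirDeriv_comm F v]
    obtain ⟨p, hp, hp'⟩ := hD u
    obtain ⟨q, hq, hq'⟩ := hD v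
    -- Euler's formula with every partial derivative replaced by its expression in the two
    -- directional ones.
    have heuler : ((d + 1 : ℕ) : ℂ) • F =
        (∑ α, a α • X α) * dirDeriv F u + (∑ α, b α • X α) * dirDeriv F v := by
      have h1 := hF.sum_X_mul_pderiv
      rw [nsmul_eq_mul] at h1
      rw [smul_eq_C_mul, map_natCast, ← h1, Finset.sum_mul, Finset.sum_mul,
        ← Finset.sum_add_distrib]
      refine Finset.sum_congr rfl fun α _ => ?_
      rw [h α, mul_add, mul_smul_comm, mul_smul_comm, smul_mul_assoc, smul_mul_assoc]
    have hd : ((d + 1 : ℕ) : ℂ) ≠ 0 := Nat.cast_ne_zero.2 d.succ_ne_zero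
    refine ⟨((d + 1 : ℕ) : ℂ)⁻¹ • (Polynomial.X * p + q), ?_, ?_⟩
    · refine (Polynomial.natDegree_smul_le _ _).trans (Polynomial.natDegree_add_le_of_degree_le
        (Polynomial.natDegree_mul_le.trans ?_) (hq.trans d.le_succ))
      rw [Polynomial.natDegree_X]
      omega
    · rw [map_smul, map_add, homogenizedValue_X_mul, homogenizedValue_succ _ _ _ hq, ← hp', ← hq',
        ← heuler, inv_smul_smul₀ hd]

/-- If any three partial derivatives of a form are linearly dependent, then it is a binary form in
two linear forms. -/
lemma exists_eq_homogenizedValue_of_not_linearIndependent {d : ℕ} {F : MvPolynomial σ ℂ}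
    (hF : F.IsHomogeneous d)
    (h : ∀ α : Fin 3 → σ, ¬ LinearIndependent ℂ fun i => pderiv (α i) F) :
    ∃ (a b : σ → ℂ) (p : Polynomial ℂ), p.natDegree ≤ d ∧
      F = homogenizedValue d (∑ α, a α • X α) (∑ α, b α • X α) p := by
  classical
  let D : σ → MvPolynomial σ ℂ := fun α => pderiv α F
  have : Module.Finite ℂ (Submodule.span ℂ (Set.range D)) :=
    FiniteDimensional.span_of_finite ℂ (Set.finite_range D)
  obtain ⟨r, f, hfs, hspan, hli⟩ : ∃ (r : ℕ) (f : Fin r → MvPolynomial σ ℂ),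
      (∀ i, f i ∈ Set.range D) ∧
      Submodule.span ℂ (Set.range f) = Submodule.span ℂ (Set.range D) ∧ LinearIndependent ℂ f :=
    ⟨_, Submodule.exists_fun_fin_finrank_span_eq ℂ (Set.range D)⟩
  choose α hα using hfs
  have hr : r ≤ 2 := by
    by_contra hr
    have hr' : 3 ≤ r := by omega
    refine h (fun i => α (Fin.castLE hr' i)) ?_
    convert hli.comp _ (Fin.castLE_injective hr') using 1
    exact funext fun i => hα _
  -- If the partials span less than a plane, the missing directions are filled with `0`.
  let u : Fin 2 → σ → ℂ := fun j => if hj : j.1 < r then Pi.single (α ⟨j, hj⟩) 1 else 0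
  have hle : Submodule.span ℂ (Set.range D) ≤
      Submodule.span ℂ {dirDeriv F (u 0), dirDeriv F (u 1)} := by
    rw [← hspan, Submodule.span_le]
    rintro _ ⟨i, rfl⟩
    have hi : dirDeriv F (u (Fin.castLE hr i)) = f i := by
      simp [u, dirDeriv_single, ← hα, D]
    rw [← hi]
    generalize Fin.castLE hr i = j
    refine Submodule.subset_span ?_
    fin_cases j <;> simp
  have hab : ∀ α, ∃ s t : ℂ, s • dirDeriv F (u 0) + t • dirDeriv F (u 1) = pderiv α F := fun α =>
    Submodule.mem_span_pair.1 (hle (Submodule.subset_span ⟨α, rfl⟩))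
  choose a b hab using hab
  exact ⟨a, b, exists_eq_homogenizedValue a b (u 0) (u 1) d F hF fun α => (hab α).symm⟩

end Catalecticant

/-! ### Power map, Veronese map, multiplication and secant variety. -/

section Forms

variable (n k d : ℕ)

instance finiteDimensional_form : FiniteDimensional ℂ (Form n k) :=
  Module.Finite.iff_fg.2 (homogeneousSubmodule_fg _ _ _)

lemma coe_multiplyOut (F : FormOfForms n k d) :
    (multiplyOut n k d F : MvPolynomial (Fin n) ℂ) = substMonomials n k F.1 := rfl

/-- The identification of forms of degree `k` with linear forms in the `Y_α`, as a linear map. -/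
def toLinearFormHom : Form n k →ₗ[ℂ] MvPolynomial (MonoIdx n k) ℂ where
  toFun := toLinearForm n k
  map_add' p q := by simp [toLinearForm, add_mul, Finset.sum_add_distrib]
  map_smul' c p := toLinearForm_smul n k c p

lemma toLinearFormHom_injective : Function.Injective (toLinearFormHom n k) := by
  rw [injective_iff_map_eq_zero]
  intro p hp
  by_contra h
  exact toLinearForm_ne_zero n k p h hp

theorem isProjectiveEmbedding_powerMap (hd : 0 < d) :
    IsProjectiveEmbedding (powerMap n k d) :=
  isProjectiveEmbedding_projMap_of_pow hd _ _ (Submodule.subtype _) Subtype.val_injective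
    (Submodule.subtype _) Subtype.val_injective fun _ => rfl

theorem isProjectiveEmbedding_veronese (hd : 0 < d) :
    IsProjectiveEmbedding (veronese n k d) :=
  isProjectiveEmbedding_projMap_of_pow hd _ _ (toLinearFormHom n k) (toLinearFormHom_injective n k)
    (Submodule.subtype _) Subtype.val_injective fun _ => rfl

/-- A monomial of degree `k * (d + 1)` has a divisor of degree `k`, which is the image of one
variable; induction handles the quotient. -/
lemma exists_substMonomials_eq_monomial (m : Fin n →₀ ℕ) (hm : m.degree = k * d) :
    ∃ F : MvPolynomial (MonoIdx n k) ℂ, F.IsHomogeneous d ∧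
      substMonomials n k F = monomial m 1 := by
  induction d generalizing m with
  | zero =>
    rw [mul_zero, Finsupp.degree_eq_zero_iff] at hm
    subst hm
    exact ⟨1, isHomogeneous_one _ _, by simp⟩
  | succ d ih =>
    obtain ⟨α, hα, hαk⟩ := Finsupp.exists_le_degree_eq m k
      (by rw [hm]; exact Nat.le_mul_of_pos_right k d.succ_pos)
    obtain ⟨β, rfl⟩ := exists_add_of_le hα
    obtain ⟨F, hF, hF'⟩ := ih β (by rw [map_add, hαk, mul_add, mul_one] at hm; omega)
    refine ⟨F * X ⟨α, mem_monoIdx.2 hαk⟩, hF.mul (isHomogeneous_X _ _), ?_⟩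
    rw [map_mul, hF', substMonomials, aeval_X, monomial_mul, add_comm, mul_one]

theorem multiplyOut_surjective : Function.Surjective (multiplyOut n k d) := by
  intro q
  have key : ∀ m : Fin n →₀ ℕ, ∃ F : FormOfForms n k d,
      substMonomials n k F.1 = monomial m (coeff m q.1) := by
    intro m
    by_cases hm : m.degree = k * d
    · obtain ⟨F, hF, hF'⟩ := exists_substMonomials_eq_monomial n k d m hm
      refine ⟨coeff m q.1 • ⟨F, hF⟩, ?_⟩
      simp [hF', smul_monomial]
    · refine ⟨0, ?_⟩
      rw [((mem_homogeneousSubmodule _ _).1 q.2).coeff_eq_zero hm]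
      simp
  choose F hF using key
  refine ⟨∑ m ∈ q.1.support, F m, Subtype.ext ?_⟩
  rw [coe_multiplyOut, AddSubmonoidClass.coe_finsetSum, map_sum]
  simp only [hF]
  exact q.1.support_sum_monomial_coeff

/-- Evaluating after the substitution is evaluating at the point `(x^α)_α`, and a polynomial over an
infinite field is zero once all its values are. -/
theorem ker_multiplyOut : LinearMap.ker (multiplyOut n k d) = veroneseIdealPart n k d := by
  ext F
  have heval : ∀ x : Fin n → ℂ, eval x (substMonomials n k F.1) =
      eval (fun α : MonoIdx n k => ∏ i, x i ^ α.1 i) F.1 := by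
    intro x
    have h : (eval x).comp (substMonomials n k : MvPolynomial (MonoIdx n k) ℂ →+* _) =
        eval (fun α : MonoIdx n k => ∏ i, x i ^ α.1 i) := by
      refine ringHom_ext (fun c => by simp) fun α => ?_
      simp [substMonomials, eval_monomial, Finsupp.prod_fintype]
    exact congrArg (fun g => g F.1) h
  rw [LinearMap.mem_ker, ← Subtype.coe_inj, coe_multiplyOut]
  change _ ↔ ∀ x : Fin n → ℂ, eval (fun α : MonoIdx n k => ∏ i, x i ^ α.1 i) F.1 = 0
  simp only [← heval]
  exact ⟨fun h x => by rw [h]; simp, fun h => MvPolynomial.funext fun x => by rw [h]; simp⟩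

/-- For `d = 0` the truncated exponent is harmless, because the scalar is then zero. -/
lemma pderiv_toLinearForm_pow (p : Form n k) (α : MonoIdx n k) :
    pderiv α (toLinearForm n k p ^ d) =
      (d * coeff α.1 p.1 : ℂ) • toLinearForm n k p ^ (d - 1) := by
  have h : pderiv α (toLinearForm n k p) = C (coeff α.1 p.1) := by
    simp [toLinearForm, pderiv_X, Pi.single_apply]
  rw [pderiv_pow, h, smul_eq_C_mul, C_mul, map_natCast]
  ring

/-- The linear map that sends a form to its directional derivatives. -/
def formDirDeriv : FormOfForms n k d →ₗ[ℂ] (MonoIdx n k → ℂ) →ₗ[ℂ] MvPolynomial (MonoIdx n k) ℂ :=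
  dirDeriv.comp (Submodule.subtype _)

/-- The right-hand side is closed, being cut out by pairing determinants, so only points on a span
of two powers matter; there the partials lie in a space spanned by two elements. -/
lemma secantVariety_veronese_subset :
    secantVariety 2 (Set.range (veronese n k d)) ⊆
      {y | ∀ α : Fin 3 → MonoIdx n k, ¬ LinearIndependent ℂ fun i => pderiv (α i) y.rep.1} := by
  classical
  let P : (Fin 3 → MonoIdx n k) × (Fin 3 → Module.Dual ℂ (MvPolynomial (MonoIdx n k) ℂ)) →
      MvPolynomial (Module.Dual ℂ (FormOfForms n k d)) ℂ := fun z =>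
    (pairingMatrix (formDirDeriv n k d) (fun i => Pi.single (z.1 i) 1) z.2).det
  refine zariskiClosure_subset ?_ ?_
  · convert isZariskiClosed_zeroLocus P _ fun z => isHomogeneous_det_pairingMatrix _ _ _ using 1
    ext y
    simp only [Set.mem_ofPred_eq, Prod.forall, P]
    refine forall_congr' fun α => ?_
    rw [forall_evalAt_det_pairingMatrix_eq_zero_iff]
    simp [formDirDeriv, dirDeriv_single]
  · rintro y ⟨x, hx, hy⟩ α hli
    have hx' : ∀ i, ∃ p, (x i).submodule = Submodule.span ℂ {linearFormPow n k d p} := by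
      intro i
      obtain ⟨z, hz⟩ := hx i
      induction z with | h p hp =>
      exact ⟨p, by rw [← hz, veronese, projMap_mk, Projectivization.submodule_mk]⟩
    choose p hp using hx'
    have hmem : y.rep ∈ Submodule.span ℂ {linearFormPow n k d (p 0), linearFormPow n k d (p 1)} := by
      have h1 : y.rep ∈ y.submodule := by
        rw [Projectivization.submodule_eq]
        exact Submodule.mem_span_singleton_self _
      have h2 := hy h1
      have h3 : ⨆ i, (x i).submodule ≤ (x 0).submodule ⊔ (x 1).submodule :=
        iSup_le fun i => by fin_cases i; exacts [le_sup_left, le_sup_right]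
      have h4 := h3 h2
      rwa [hp, hp, ← Submodule.span_union, Set.singleton_union] at h4
    obtain ⟨s, t, hst⟩ := Submodule.mem_span_pair.1 hmem
    let G : Fin 2 → MvPolynomial (MonoIdx n k) ℂ := fun j => toLinearForm n k (p j) ^ (d - 1)
    have hle : Submodule.span ℂ (Set.range fun i => pderiv (α i) y.rep.1) ≤
        Submodule.span ℂ (Set.range G) := by
      rw [Submodule.span_le]
      rintro _ ⟨i, rfl⟩
      have h1 : y.rep.1 = s • toLinearForm n k (p 0) ^ d + t • toLinearForm n k (p 1) ^ d := by
        rw [← hst]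
        rfl
      change pderiv (α i) y.rep.1 ∈ _
      rw [h1, map_add, Derivation.map_smul, Derivation.map_smul, pderiv_toLinearForm_pow,
        pderiv_toLinearForm_pow]
      exact add_mem
        (Submodule.smul_mem _ _ (Submodule.smul_mem _ _ (Submodule.subset_span ⟨0, rfl⟩)))
        (Submodule.smul_mem _ _ (Submodule.smul_mem _ _ (Submodule.subset_span ⟨1, rfl⟩)))
    have := FiniteDimensional.span_of_finite ℂ (Set.finite_range G)
    have h3 := Submodule.finrank_mono hle
    rw [finrank_span_eq_card hli, Fintype.card_fin] at h3
    have h4 := finrank_range_le_card (R := ℂ) G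
    rw [Set.finrank, Fintype.card_fin] at h4
    omega

theorem secantVariety_veronese_inter_projSubspace :
    secantVariety 2 (Set.range (veronese n k d)) ∩
      projSubspace (LinearMap.ker (multiplyOut n k d)) = ∅ := by
  rw [Set.eq_empty_iff_forall_notMem]
  rintro y ⟨hy, hyE⟩
  have hy0 : substMonomials n k y.rep.1 = 0 := by
    have h1 : y.rep ∈ y.submodule := by
      rw [Projectivization.submodule_eq]
      exact Submodule.mem_span_singleton_self _
    have h2 := LinearMap.mem_ker.1 (hyE h1)
    rw [← coe_multiplyOut, h2]
    rfl
  obtain ⟨a, b, p, hp, hF⟩ := exists_eq_homogenizedValue_of_not_linearIndependent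
    ((mem_homogeneousSubmodule _ _).1 y.rep.2) (secantVariety_veronese_subset n k d hy)
  refine y.rep_nonzero (Subtype.ext ?_)
  rw [hF] at hy0 ⊢
  refine homogenizedValue_eq_zero_of_map_eq_zero _ (fun s t h => ?_) d p hp hy0
  have hlin : s • ∑ α, a α • X α + t • ∑ α, b α • X α =
      ∑ α : MonoIdx n k, (s * a α + t * b α) • (X α : MvPolynomial (MonoIdx n k) ℂ) := by
    simp [Finset.smul_sum, add_smul, mul_smul, Finset.sum_add_distrib]
  rw [hlin] at h ⊢
  refine Finset.sum_eq_zero fun β _ => ?_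
  -- Distinct variables go to distinct monomials, so the coefficient at `β` of the image is that of
  -- the linear form.
  have hc := congrArg (coeff β.1) h
  simp only [map_sum, map_smul, substMonomials, aeval_X, coeff_sum, coeff_smul, coeff_monomial,
    coeff_zero, Subtype.coe_inj] at hc
  have : s * a β + t * b β = 0 := by simpa using hc
  rw [this, zero_smul]

lemma multiplyOut_linearFormPow (p : Form n k) :
    multiplyOut n k d (linearFormPow n k d p) = formPow n k d p := by
  refine Subtype.ext ?_
  rw [coe_multiplyOut]
  change substMonomials n k (toLinearForm n k p ^ d) = p.1 ^ d
  rw [map_pow, substMonomials_toLinearForm]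

lemma veronese_notMem_projSubspace (p : Projectivization ℂ (Form n k)) :
    veronese n k d p ∉ projSubspace (LinearMap.ker (multiplyOut n k d)) := by
  induction p with | h p hp =>
  intro h
  have h1 : linearFormPow n k d p ∈ LinearMap.ker (multiplyOut n k d) := by
    refine h ?_
    rw [veronese, projMap_mk, Projectivization.submodule_mk]
    exact Submodule.mem_span_singleton_self _
  rw [LinearMap.mem_ker, multiplyOut_linearFormPow] at h1
  exact pow_ne_zero d (fun h2 => hp (Subtype.ext h2)) (congrArg Subtype.val h1)

lemma linearProjection_mk {V W : Type*} [AddCommGroup V] [Module ℂ V] [AddCommGroup W]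
    [Module ℂ W] (π : V →ₗ[ℂ] W) (v : V) (hv : v ≠ 0) (hπ : π v ≠ 0)
    (h : Projectivization.mk ℂ v hv ∉ projSubspace (LinearMap.ker π)) :
    linearProjection π (Projectivization.mk ℂ v hv) h = Projectivization.mk ℂ (π v) hπ := by
  obtain ⟨a, ha⟩ := Projectivization.exists_smul_eq_mk_rep ℂ v hv
  refine (Projectivization.mk_eq_mk_iff' ℂ _ _ _ _).2 ⟨a, ?_⟩
  rw [← ha, Units.smul_def, map_smul]

lemma powerMap_eq_linearProjection_veronese (p : Projectivization ℂ (Form n k)) :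
    powerMap n k d p = linearProjection (multiplyOut n k d) (veronese n k d p)
      (veronese_notMem_projSubspace n k d p) := by
  induction p with | h p hp =>
  have hne : multiplyOut n k d (linearFormPow n k d p) ≠ 0 := by
    rw [multiplyOut_linearFormPow]
    exact fun h => pow_ne_zero d (fun h2 => hp (Subtype.ext h2)) (congrArg Subtype.val h)
  refine Eq.trans ?_ (linearProjection_mk (multiplyOut n k d) (linearFormPow n k d p) _ hne _).symm
  refine (Projectivization.mk_eq_mk_iff' ℂ _ _ _ _).2 ⟨1, ?_⟩
  rw [one_smul, multiplyOut_linearFormPow]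

end Forms

end FormPowers

end

theorem mainTheorem9 (n k d : ℕ) (hd : 0 < d) :
    FormPowers.IsProjectiveEmbedding (FormPowers.powerMap n k d) ∧
    FormPowers.IsProjectiveEmbedding (FormPowers.veronese n k d) ∧
    Function.Surjective (FormPowers.multiplyOut n k d) ∧
    LinearMap.ker (FormPowers.multiplyOut n k d) = FormPowers.veroneseIdealPart n k d ∧
    FormPowers.secantVariety 2 (Set.range (FormPowers.veronese n k d)) ∩
      FormPowers.projSubspace (LinearMap.ker (FormPowers.multiplyOut n k d)) = ∅ ∧
    ∃ h : ∀ p, FormPowers.veronese n k d p ∉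
        FormPowers.projSubspace (LinearMap.ker (FormPowers.multiplyOut n k d)),
      ∀ p, FormPowers.powerMap n k d p =
        FormPowers.linearProjection (FormPowers.multiplyOut n k d)
          (FormPowers.veronese n k d p) (h p) :=
  ⟨FormPowers.isProjectiveEmbedding_powerMap n k d hd,
    FormPowers.isProjectiveEmbedding_veronese n k d hd,
    FormPowers.multiplyOut_surjective n k d,
    FormPowers.ker_multiplyOut n k d,
    FormPowers.secantVariety_veronese_inter_projSubspace n k d,
    FormPowers.veronese_notMem_projSubspace n k d,
    FormPowers.powerMap_eq_linearProjection_veronese n k d⟩
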